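/- Let $M$ be a matroid on the ground set $E=\{1,\dots,n\}$ and let $P(M)\subset\mathbb{R}^n$ be its matroid base polytope, that is, the convex hull of the incidence vectors $\sum_{i\in B}e_i$ of the bases $B$ of $M$. Suppose that the 1-skeleton of $P(M)$ (the graph formed by the vertices and edges of $P(M)$) is isomorphic to the graph of the $d$-dimensional hypercube for some $d\ge 0$. Then $P(M)$ is indecomposable: there do not exist an integer $t\ge 2$ and matroids $M_1,\dots,M_t$ on $E$ with $P(M_i)\neq P(M)$ for every $i$ such that $P(M)=\bigcup_{i=1}^{t}P(M_i)$ and, for all $1\le i\neq j\le t$, the intersection $P(M_i)\cap P(M_j)$ is a (possibly empty) face of both $P(M_i)$ and $P(M_j)$. -/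

import Mathlib

namespace MatroidPolytope

/-- The matroid base polytope `P(M)`: the convex hull in `ℝ^α` of the incidence vectors of the
bases of `M`. -/
def basePolytope {α : Type*} (M : Matroid α) : Set (α → ℝ) :=
  convexHull ℝ {x | ∃ B : Set α, M.IsBase B ∧ x = B.indicator 1}

/-- `F` is a face of the polytope `P`: it is empty, or the set of points of `P` at which some
linear functional attains its maximum over `P`. (`P` is a face of itself, by the functional `0`.) -/
def IsFace {α : Type*} (P F : Set (α → ℝ)) : Prop :=
  IsExposed ℝ P F

/-- The vertices of the polytope `P`: the points `v` such that `{v}` is a face of `P`. -/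
def vertices {α : Type*} (P : Set (α → ℝ)) : Set (α → ℝ) :=
  {v | IsFace P {v}}

/-- The 1-skeleton of the polytope `P`: the graph on the vertices of `P` in which two distinct
vertices are adjacent when the segment joining them is a face (an edge) of `P`. -/
def oneSkeleton {α : Type*} (P : Set (α → ℝ)) : SimpleGraph (vertices P) where
  Adj u v := u ≠ v ∧ IsFace P (segment ℝ (u : α → ℝ) (v : α → ℝ))
  symm := ⟨fun u v h => ⟨h.1.symm, by rw [segment_symm]; exact h.2⟩⟩
  loopless := ⟨fun _ h => h.1 rfl⟩

/-- The graph of the `d`-dimensional hypercube: vertices are the 0/1-words of length `d`, and two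
words are adjacent when they differ in exactly one position. -/
def hypercube (d : ℕ) : SimpleGraph (Fin d → Bool) where
  Adj x y := hammingDist x y = 1
  symm := ⟨fun x y h => by rw [hammingDist_comm]; exact h⟩
  loopless := ⟨fun x h => by simp at h⟩

/-- `P(M) = ⋃ P(N i)` is a matroid base polytope decomposition: the `N i` are matroids on the ground
set of `M`, their base polytopes cover `P(M)` exactly, and any two of them meet in a common face. -/
structure IsBasePolytopeDecomposition {α : Type*} (M : Matroid α) {t : ℕ}
    (N : Fin t → Matroid α) : Prop where
  ground_eq : ∀ i, (N i).E = M.E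
  eq_iUnion : basePolytope M = ⋃ i, basePolytope (N i)
  inter_isFace : ∀ i j, i ≠ j →
    IsFace (basePolytope (N i)) (basePolytope (N i) ∩ basePolytope (N j)) ∧
    IsFace (basePolytope (N j)) (basePolytope (N i) ∩ basePolytope (N j))

/-- `P(M)` is decomposable: it has a nontrivial matroid base polytope decomposition into `t ≥ 2`
pieces. Nontrivial means that no piece is all of `P(M)`; without this, `P(M) = P(M) ∪ P(M)` would
count for every matroid. Pieces of smaller dimension are allowed. -/
def IsDecomposable {α : Type*} (M : Matroid α) : Prop :=
  ∃ t : ℕ, 2 ≤ t ∧ ∃ N : Fin t → Matroid α, IsBasePolytopeDecomposition M N ∧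
    ∀ i, basePolytope (N i) ≠ basePolytope M

/-- `P(M)` is indecomposable: it is not decomposable. -/
def IsIndecomposable {α : Type*} (M : Matroid α) : Prop :=
  ¬ IsDecomposable M

end MatroidPolytope

/-! Bases differing by one exchange span an edge, so bases `I + x`, `I + y`, `I + z` with distinct
`x, y, z ∉ I` would form a triangle. Hypercubes have none, so an element `x` of a base of `M` can be
exchanged for at most one other element (`exchange_unique`). In a decomposition, some piece `P(N)`
contains the barycentre of the bases of `M`. Its `x`-coordinate is below `1` unless `x` is a coloop
of `M`, so every coloop of `N` is one of `M`. If `B` is a base of `N` and `B - x + y` one of `M`,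
then `N` has a base avoiding `x`, hence a base `B - x + z`; this is also a base of `M`, so
uniqueness forces `z = y`. The bases of `N` are thus closed under exchanges of `M`, and `P(N) =
P(M)`. -/

namespace MatroidPolytope

open Set

variable {α : Type*}

/-- The linear functional maximised by `l` over the convex hull of `S` cuts out the convex hull of
the maximisers in `S`. -/
theorem isFace_convexHull_of_forall_le {S T : Set (α → ℝ)} (l : StrongDual ℝ (α → ℝ)) {m : ℝ}
    (hTS : T ⊆ S) (hT : ∀ x ∈ T, l x = m) (hST : ∀ x ∈ S, x ∉ T → l x < m) :
    IsFace (convexHull ℝ S) (convexHull ℝ T) := by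
  rintro ⟨x₀, hx₀⟩
  have hTm : ∀ x ∈ convexHull ℝ T, l x = m := fun x hx =>
    convexHull_min (t := {x | l x = m}) hT
      (convex_hyperplane l.toLinearMap.isLinear m) hx
  -- Adding part of the hyperplane `l = m` to the open half-space keeps it convex if that part is
  -- convex. The union contains `S`, hence its hull.
  have hC : Convex ℝ (convexHull ℝ T ∪ {x | l x < m}) := by
    rw [convex_iff_forall_pos]
    intro x hx y hy a b ha hb hab
    have hle : ∀ z ∈ convexHull ℝ T ∪ {x | l x < m}, l z ≤ m := by
      rintro z (hz | hz)
      · exact (hTm z hz).le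
      · exact le_of_lt hz
    have hxm := hle x hx
    have hym := hle y hy
    have hm : m = a * m + b * m := by rw [← add_mul, hab, one_mul]
    rcases hx with hx | hx
    · rcases hy with hy | hy
      · exact Or.inl (convex_convexHull ℝ T hx hy ha.le hb.le hab)
      · right
        simp only [mem_ofPred_eq, map_add, map_smul, smul_eq_mul] at hy ⊢
        have h1 := mul_le_mul_of_nonneg_left hxm ha.le
        have h2 := mul_lt_mul_of_pos_left hy hb
        linarith
    · right
      simp only [mem_ofPred_eq, map_add, map_smul, smul_eq_mul] at hx ⊢
      have h1 := mul_lt_mul_of_pos_left hx ha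
      have h2 := mul_le_mul_of_nonneg_left hym hb.le
      linarith
  have hSC : convexHull ℝ S ⊆ convexHull ℝ T ∪ {x | l x < m} := by
    refine convexHull_min (fun x hx => ?_) hC
    by_cases hxT : x ∈ T
    · exact Or.inl (subset_convexHull ℝ T hxT)
    · exact Or.inr (hST x hx hxT)
  refine ⟨l, Subset.antisymm (fun x hx => ⟨convexHull_mono hTS hx, fun y hy => ?_⟩) ?_⟩
  · rw [hTm x hx]
    rcases hSC hy with h | h
    · exact (hTm y h).le
    · exact le_of_lt h
  · rintro x ⟨hx, hmax⟩
    rcases hSC hx with h | h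
    · exact h
    · have := hmax x₀ (convexHull_mono hTS hx₀)
      rw [hTm x₀ hx₀] at this
      exact absurd h (not_lt.2 this)

/-- The functional `x ↦ ∑ a ∈ B, x a`. -/
noncomputable def sumOver [Fintype α] (B : Set α) : StrongDual ℝ (α → ℝ) :=
  ∑ a, B.indicator (1 : α → ℝ) a • ContinuousLinearMap.proj (R := ℝ) (φ := fun _ : α => ℝ) a

theorem sumOver_indicator [Fintype α] (B C : Set α) :
    sumOver B (C.indicator 1) = ((B ∩ C).ncard : ℝ) := by
  classical
  have h : ∀ a, B.indicator (1 : α → ℝ) a * C.indicator 1 a = if a ∈ B ∩ C then 1 else 0 := by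
    intro a
    by_cases hB : a ∈ B <;> by_cases hC : a ∈ C <;> simp [hB, hC]
  simp only [sumOver, FunLike.coe_sum, Finset.sum_apply, FunLike.coe_smul,
    Pi.smul_apply, ContinuousLinearMap.proj_apply, smul_eq_mul, h, Finset.sum_boole]
  rw [Set.ncard_eq_toFinset_card']
  congr 2
  ext a
  simp

theorem ncard_inter_lt [Finite α] {M : Matroid α} {B C : Set α} (hB : M.IsBase B)
    (hC : M.IsBase C) (h : B ≠ C) : (B ∩ C).ncard < B.ncard :=
  Set.ncard_lt_ncard
    (inter_subset_left.ssubset_of_ne fun e => h (hB.eq_of_subset_isBase hC (inter_eq_left.1 e)))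
    (toFinite _)

theorem indicator_one_injective {B C : Set α}
    (h : B.indicator (1 : α → ℝ) = C.indicator 1) : B = C := by
  ext a
  have := congrFun h a
  by_cases hB : a ∈ B <;> by_cases hC : a ∈ C <;> simp_all

theorem indicator_mem_vertices [Finite α] {M : Matroid α} {B : Set α} (hB : M.IsBase B) :
    B.indicator 1 ∈ vertices (basePolytope M) := by
  have := Fintype.ofFinite α
  rw [vertices, mem_ofPred_eq, ← convexHull_singleton (𝕜 := ℝ)]
  refine isFace_convexHull_of_forall_le (sumOver B) (m := B.ncard) ?_ ?_ ?_
  · rintro _ rfl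
    exact ⟨B, hB, rfl⟩
  · rintro _ rfl
    rw [sumOver_indicator, inter_self]
  · rintro _ ⟨C, hC, rfl⟩ hne
    rw [sumOver_indicator]
    exact_mod_cast ncard_inter_lt hB hC fun e => hne (by rw [e]; rfl)

/-- Bases which differ by a single exchange span an edge of the base polytope. -/
theorem isFace_segment_of_insert [Finite α] {M : Matroid α} {I : Set α} {y z : α}
    (hy : M.IsBase (insert y I)) (hz : M.IsBase (insert z I)) (hyI : y ∉ I) (hzI : z ∉ I)
    (hyz : y ≠ z) :
    IsFace (basePolytope M)
      (segment ℝ ((insert y I).indicator 1) ((insert z I).indicator 1)) := by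
  have := Fintype.ofFinite α
  have hyI' : (insert y I).ncard = I.ncard + 1 := ncard_insert_of_notMem hyI
  have hzI' : (insert z I).ncard = I.ncard + 1 := ncard_insert_of_notMem hzI
  have hinter : insert y I ∩ insert z I = I := by
    ext a
    simp only [mem_inter_iff, mem_insert_iff]
    grind
  rw [← convexHull_pair]
  -- At a base `C` this is the sum of the sizes of its intersections with the two bases. Both
  -- endpoints give `(|I| + 1) + |I|`; any other base loses at least one in each term, so gives at
  -- most `2|I|`.
  refine isFace_convexHull_of_forall_le (sumOver (insert y I) + sumOver (insert z I))
    (m := 2 * I.ncard + 1) ?_ ?_ ?_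
  · rintro _ (rfl | rfl)
    exacts [⟨_, hy, rfl⟩, ⟨_, hz, rfl⟩]
  · rintro _ (rfl | rfl)
    · rw [add_apply, sumOver_indicator, sumOver_indicator, inter_self,
        inter_comm, hinter, hyI']
      push_cast
      ring
    · rw [add_apply, sumOver_indicator, sumOver_indicator, inter_self, hinter,
        hzI']
      push_cast
      ring
  · rintro _ ⟨C, hC, rfl⟩ hne
    have h1 := ncard_inter_lt hy hC fun e => hne (Or.inl (by rw [e]))
    have h2 := ncard_inter_lt hz hC fun e => hne (Or.inr (by rw [e]; rfl))
    rw [add_apply, sumOver_indicator, sumOver_indicator]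
    have : (insert y I ∩ C).ncard + (insert z I ∩ C).ncard < 2 * I.ncard + 1 := by omega
    exact_mod_cast this

theorem oneSkeleton_adj_of_insert [Finite α] {M : Matroid α} {I : Set α} {y z : α}
    (hy : M.IsBase (insert y I)) (hz : M.IsBase (insert z I)) (hyI : y ∉ I) (hzI : z ∉ I)
    (hyz : y ≠ z) :
    (oneSkeleton (basePolytope M)).Adj ⟨_, indicator_mem_vertices hy⟩
      ⟨_, indicator_mem_vertices hz⟩ := by
  refine ⟨fun e => ?_, isFace_segment_of_insert hy hz hyI hzI hyz⟩
  have h : insert y I = insert z I := indicator_one_injective (congrArg Subtype.val e)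
  have : y ∈ insert z I := h ▸ mem_insert y I
  grind

/-- The three positions of difference must coincide, and there three Booleans cannot be pairwise
distinct. -/
theorem hypercube_triangle_free {d : ℕ} {u v w : Fin d → Bool} (huv : (hypercube d).Adj u v)
    (hvw : (hypercube d).Adj v w) (huw : (hypercube d).Adj u w) : False := by
  replace huv : hammingDist u v = 1 := huv
  replace hvw : hammingDist v w = 1 := hvw
  replace huw : hammingDist u w = 1 := huw
  rw [hammingDist, Finset.card_eq_one] at huv hvw huw
  obtain ⟨i, hi⟩ := huv
  obtain ⟨j, hj⟩ := hvw
  obtain ⟨k, hk⟩ := huw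
  simp only [Finset.ext_iff, Finset.mem_filter, Finset.mem_univ, true_and,
    Finset.mem_singleton] at hi hj hk
  obtain rfl : i = j := by
    have := hi i; have := hi j; have := hj i; have := hj j; have := hk i; have := hk j
    grind
  obtain rfl : i = k := by
    have := hi k; have := hj k; have := hk k
    grind
  have h1 := (hi i).2 rfl
  have h2 := (hj i).2 rfl
  have h3 := (hk i).2 rfl
  cases hu : u i <;> cases hv : v i <;> cases hw : w i <;> simp_all

/-- If the `1`-skeleton is a hypercube, an element of a base can be exchanged in at most one
way. -/
theorem exchange_unique [Finite α] {M : Matroid α} {d : ℕ}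
    (e : oneSkeleton (basePolytope M) ≃g hypercube d) {I : Set α} {x y z : α}
    (hx : M.IsBase (insert x I)) (hy : M.IsBase (insert y I)) (hz : M.IsBase (insert z I))
    (hxI : x ∉ I) (hyI : y ∉ I) (hzI : z ∉ I) (hxy : x ≠ y) (hxz : x ≠ z) : y = z := by
  by_contra hyz
  exact hypercube_triangle_free
    (e.map_adj_iff.2 (oneSkeleton_adj_of_insert hx hy hxI hyI hxy))
    (e.map_adj_iff.2 (oneSkeleton_adj_of_insert hy hz hyI hzI hyz))
    (e.map_adj_iff.2 (oneSkeleton_adj_of_insert hx hz hxI hzI hxz))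

theorem isBase_of_basePolytope_subset [Finite α] {M N : Matroid α}
    (h : basePolytope N ⊆ basePolytope M) {B : Set α} (hB : N.IsBase B) : M.IsBase B := by
  have := Fintype.ofFinite α
  by_contra hBM
  -- Among all 0/1-vectors this functional is maximal only at that of `B`. Subtracting the
  -- complement is needed as `M` and `N` are not assumed to have equal rank.
  have hlt : basePolytope M ⊆ {x | (sumOver B - sumOver Bᶜ) x < B.ncard} := by
    refine convexHull_min ?_
      (convex_halfSpace_lt (sumOver B - sumOver Bᶜ).toLinearMap.isLinear _)
    rintro _ ⟨C, hC, rfl⟩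
    rw [mem_ofPred_eq, sub_apply, sumOver_indicator, sumOver_indicator]
    have h1 : (B ∩ C).ncard < B.ncard + (Bᶜ ∩ C).ncard := by
      by_cases hBC : B ⊆ C
      · have hCB : (Bᶜ ∩ C).Nonempty := by
          by_contra hemp
          rw [not_nonempty_iff_eq_empty, inter_comm, ← sdiff_eq, sdiff_eq_empty] at hemp
          exact hBM (hBC.antisymm hemp ▸ hC)
        have := (ncard_pos (toFinite _)).2 hCB
        have := ncard_le_ncard (inter_subset_left (s := B) (t := C)) (toFinite _)
        omega
      · have := ncard_lt_ncard (inter_subset_left.ssubset_of_ne fun e => hBC (inter_eq_left.1 e))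
          (toFinite B)
        omega
    have : ((B ∩ C).ncard : ℝ) < B.ncard + (Bᶜ ∩ C).ncard := by exact_mod_cast h1
    linarith
  have hmem := hlt (h (subset_convexHull ℝ _ ⟨B, hB, rfl⟩))
  rw [mem_ofPred_eq, sub_apply, sumOver_indicator, sumOver_indicator,
    inter_self, compl_inter_self, ncard_empty] at hmem
  simp at hmem

/-- The base polytope has a point all of whose coordinates, except those of coloops, are smaller
than `1`. -/
theorem exists_mem_basePolytope_lt_one [Finite α] (M : Matroid α) :
    ∃ c ∈ basePolytope M, ∀ a, (∃ B, M.IsBase B ∧ a ∉ B) → c a < 1 := by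
  classical
  let S : Finset (Set α) := (toFinite {B | M.IsBase B}).toFinset
  have hS : ∀ B, B ∈ S ↔ M.IsBase B := fun B => by simp [S]
  obtain ⟨B₀, hB₀⟩ := M.exists_isBase
  have hpos : 0 < (S.card : ℝ) := by
    exact_mod_cast Finset.card_pos.2 ⟨B₀, (hS B₀).2 hB₀⟩
  -- The barycentre: its `a`-coordinate is the proportion of bases containing `a`.
  refine ⟨∑ B ∈ S, (S.card : ℝ)⁻¹ • B.indicator 1, ?_, fun a ⟨B, hB, haB⟩ => ?_⟩
  · refine (convex_convexHull ℝ _).sum_mem (fun _ _ => by positivity) ?_ fun B hB =>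
      subset_convexHull ℝ _ ⟨B, (hS B).1 hB, rfl⟩
    rw [Finset.sum_const, nsmul_eq_mul, mul_inv_cancel₀ hpos.ne']
  · rw [← Finset.smul_sum, Pi.smul_apply, Finset.sum_apply, smul_eq_mul, inv_mul_lt_iff₀ hpos,
      mul_one]
    calc ∑ C ∈ S, C.indicator (1 : α → ℝ) a < ∑ C ∈ S, 1 := by
          refine Finset.sum_lt_sum (fun C _ => ?_) ⟨B, (hS B).2 hB, by simp [haB]⟩
          exact indicator_le_self' (fun _ _ => zero_le_one) a
      _ = S.card := by simp

theorem exists_isBase_notMem_of_lt_one {N : Matroid α} {c : α → ℝ} (hc : c ∈ basePolytope N)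
    {a : α} (ha : c a < 1) : ∃ B, N.IsBase B ∧ a ∉ B := by
  by_contra! h
  have : basePolytope N ⊆ {x | x a = 1} := by
    refine convexHull_min ?_ (convex_hyperplane (LinearMap.proj a).isLinear 1)
    rintro _ ⟨B, hB, rfl⟩
    simp [h B hB]
  exact ha.ne (this hc)

/-- A set of bases of `M` containing a base and closed under the single exchanges of `M` contains
all bases. -/
theorem isBase_of_exchange_closed [Finite α] {M N : Matroid α}
    (hNM : ∀ B, N.IsBase B → M.IsBase B)
    (hex : ∀ B x y, N.IsBase B → x ∈ B → y ∉ B → M.IsBase (insert y (B \ {x})) →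
      N.IsBase (insert y (B \ {x}))) {B' : Set α} (hB' : M.IsBase B') : N.IsBase B' := by
  obtain ⟨B₀, hB₀⟩ := N.exists_isBase
  induction hn : (B₀ \ B').ncard using Nat.strong_induction_on generalizing B₀ with
  | _ n ih =>
    obtain hemp | ⟨x, hx⟩ := (B₀ \ B').eq_empty_or_nonempty
    · rwa [← (hNM _ hB₀).eq_of_subset_isBase hB' (sdiff_eq_empty.1 hemp)]
    · obtain ⟨y, hy, hBy⟩ := (hNM _ hB₀).exchange hB' hx
      refine ih _ ?_ _ (hex _ _ _ hB₀ hx.1 hy.2 hBy) rfl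
      rw [← hn]
      refine ncard_lt_ncard ⟨?_, fun h => ?_⟩ (toFinite _)
      · rintro a ⟨rfl | ha, haB⟩
        · exact absurd hy.1 haB
        · exact ⟨ha.1, haB⟩
      · rcases (h hx).1 with rfl | h
        · exact hy.2 hx.1
        · exact h.2 rfl

end MatroidPolytope

open MatroidPolytope in
theorem corollary7 {α : Type*} [Finite α] (M : Matroid α) (hE : M.E = Set.univ)
    (hM : ∃ d : ℕ, Nonempty (MatroidPolytope.oneSkeleton (MatroidPolytope.basePolytope M) ≃g
      MatroidPolytope.hypercube d)) :
    MatroidPolytope.IsIndecomposable M := by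
  obtain ⟨d, ⟨e⟩⟩ := hM
  rintro ⟨t, -, N, hN, hne⟩
  obtain ⟨c, hcM, hc⟩ := exists_mem_basePolytope_lt_one M
  obtain ⟨i, hci⟩ := Set.mem_iUnion.1 (hN.eq_iUnion ▸ hcM)
  have hsub : basePolytope (N i) ⊆ basePolytope M :=
    hN.eq_iUnion ▸ Set.subset_iUnion (fun i => basePolytope (N i)) i
  have hNM : ∀ B, (N i).IsBase B → M.IsBase B := fun B => isBase_of_basePolytope_subset hsub
  refine hne i (hsub.antisymm (convexHull_mono ?_))
  rintro _ ⟨B, hB, rfl⟩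
  refine ⟨B, isBase_of_exchange_closed hNM (fun B x y hB hx hy hBy => ?_) hB, rfl⟩
  have hxy : x ≠ y := fun h => hy (h ▸ hx)
  -- The base `B - x + y` shows that `x` is not a coloop of `M`, so `c x < 1`, and `x` is not a
  -- coloop of `N i`.
  obtain ⟨B', hB', hxB'⟩ := exists_isBase_notMem_of_lt_one hci
    (hc x ⟨_, hBy, by simp [hxy]⟩)
  obtain ⟨z, hz, hBz⟩ := hB.exchange hB' ⟨hx, hxB'⟩
  have hyz : y = z := exchange_unique e (x := x)
    (by rw [Set.insert_sdiff_singleton, Set.insert_eq_of_mem hx]; exact hNM _ hB) hBy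
    (hNM _ hBz) (by simp) (fun h => hy h.1) (fun h => hz.2 h.1) hxy
    (fun h => hz.2 (h ▸ hx))
  rwa [hyz]
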